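/- Let $G=(V,E)$ be a finite connected graph, possibly with parallel edges but without loops. A spanning forest of $G$ is a subgraph that contains all vertices of $G$ and no cycle. Let $\kappa(G)$ be the number of spanning trees of $G$ (spanning forests with exactly one connected component) and $\kappa_2(G)$ the number of two-forests of $G$ (spanning forests with exactly two connected components). Then $$\frac{\kappa_2(G)}{\kappa(G)} \;\ge\; \frac{(|V|-1)^2}{4|E|},$$ where the right-hand side is read as $0$ if $G$ has a single vertex (and hence no edge). -/

import Mathlib

namespace Graph

variable {α β : Type*}

/-- Two vertices are reachable from each other if they are joined by a finite chain of adjacent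
vertices. -/
def Reachable (G : Graph α β) (x y : α) : Prop :=
  Relation.ReflTransGen G.Adj x y

/-- A graph is connected if it has a vertex and any two of its vertices are reachable from each
other. -/
def IsConnected (G : Graph α β) : Prop :=
  G.vertexSet.Nonempty ∧ ∀ x ∈ G.vertexSet, ∀ y ∈ G.vertexSet, G.Reachable x y

/-- The vertex set of the connected component of the vertex `x`. -/
def component (G : Graph α β) (x : α) : Set α :=
  {y | G.Reachable x y}

/-- The number of connected components of a graph (with finitely many vertices). -/
noncomputable def numComponents (G : Graph α β) : ℕ :=
  {C : Set α | ∃ x ∈ G.vertexSet, C = G.component x}.ncard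

/-- The graph contains a cycle: distinct vertices `v 0, …, v n` and distinct edges
`e 0, …, e n` such that `e i` joins `v i` to `v (i + 1)`, the indices being taken cyclically
(addition in `Fin (n + 1)` wraps around). For `n = 0` this is a loop, and for `n = 1` a pair of
parallel edges. -/
def HasCycle (G : Graph α β) : Prop :=
  ∃ (n : ℕ) (v : Fin (n + 1) → α) (e : Fin (n + 1) → β),
    Function.Injective v ∧ Function.Injective e ∧
      ∀ i : Fin (n + 1), G.IsLink (e i) (v i) (v (i + 1))

/-- `F` is an `r`-forest of `G`: a subgraph of `G` that contains all the vertices of `G`, contains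
no cycle, and has exactly `r` connected components. -/
structure IsSpanningForest (G : Graph α β) (r : ℕ) (F : Graph α β) : Prop where
  isSpanningSubgraph : F.IsSpanningSubgraph G
  not_hasCycle : ¬ F.HasCycle
  numComponents_eq : F.numComponents = r

/-- The number `κ_r(G)` of `r`-forests of `G` (for a finite graph `G`). In particular
`κ_1(G) = κ(G)` is the number of spanning trees and `κ_2(G)` is the number of two-forests. -/
noncomputable def numForests (G : Graph α β) (r : ℕ) : ℕ :=
  {F : Graph α β | G.IsSpanningForest r F}.ncard

/-- The number `κ(G)` of spanning trees of `G`. -/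
noncomputable def numSpanningTrees (G : Graph α β) : ℕ :=
  G.numForests 1

end Graph

/-! Fix a root `q`. Let `g` be the inverse of the Laplacian grounded at `q`, set to zero at `q`, and
for an edge `e = st` let `R e = g s s + g t t - 2 * g s t` be its effective resistance. In a
two-forest `F`, the component avoiding `q` is a tree, so it has one more vertex than edges. Summing
over all `F` writes `κ₂` as a count of pairs (two-forest, vertex off the root's side) minus a count
of pairs (two-forest, edge off the root's side) (`card_twoForests_add_sum`). By the all-minors
matrix tree theorem (`det_groundedLaplacian`) and the formulas for minors of an inverse, a vertex
contributes `κ * g x x` and an edge `κ * (g s s * g t t - (g s t)^2)`.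

The identity `sum_green_trace` turns the vertex sum into an edge sum as well, and the difference
becomes a sum of squares (`card_twoForests_eq_sum_sq`): `κ₂ / κ = ∑ e, ((R e)^2 / 4 + 3 / 4 * (g s s
- g t t)^2)`. Dropping the second square, Cauchy–Schwarz and Foster's theorem `∑ e, R e = |V| - 1`
give the bound. -/

namespace Graph

/-! ### Rooted forests and the matrix tree theorem. -/

section RootedForests

open Finset Matrix

variable {V β : Type*} (s t : β → V)

/-- The edges of `F`, where `e` joins `s e` and `t e`, connect every vertex to a vertex of `S`:
a vertex set that contains `S` and is a union of connected components is everything. -/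
def Spans (F : Finset β) (S : Finset V) : Prop :=
  ∀ U : Set V, (S : Set V) ⊆ U → (∀ e ∈ F, s e ∈ U ↔ t e ∈ U) → ∀ v, v ∈ U

/-- The edge `e` joins `a` and `b`. -/
def Joins (e : β) (a b : V) : Prop :=
  (s e = a ∧ t e = b) ∨ (s e = b ∧ t e = a)

variable {s t} {E F : Finset β} {S : Finset V} {e : β} {a b : V}

lemma Joins.mem_iff_mem (h : Joins s t e a b) (U : Set V) :
    (s e ∈ U ↔ t e ∈ U) ↔ (a ∈ U ↔ b ∈ U) := by
  rcases h with ⟨rfl, rfl⟩ | ⟨rfl, rfl⟩ <;> tauto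

/-- Contraction: an edge leaving a root can be traded for its far end as a new root, since a closed
set containing `a` must contain `b`. -/
lemma spans_iff_of_joins [DecidableEq V] [DecidableEq β] (he : e ∈ F) (h : Joins s t e a b)
    (ha : a ∈ S) : Spans s t F S ↔ Spans s t (F.erase e) (insert b S) := by
  constructor
  · intro hF U hS hU
    have hS' : (S : Set V) ⊆ U ∧ b ∈ U := by
      simpa [Set.insert_subset_iff, and_comm] using hS
    refine hF U hS'.1 fun d hd ↦ ?_
    by_cases hde : d = e
    · subst hde
      rw [h.mem_iff_mem]
      exact iff_of_true (hS'.1 ha) hS'.2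
    · exact hU d (mem_erase.2 ⟨hde, hd⟩)
  · intro hF U hS hU
    have hb : b ∈ U := ((h.mem_iff_mem U).1 (hU e he)).1 (hS ha)
    refine hF U ?_ fun d hd ↦ hU d (mem_of_mem_erase hd)
    simpa [Set.insert_subset_iff] using ⟨hb, hS⟩

lemma Spans.exists_joins (h : Spans s t F S) {v : V} (hv : v ∉ S) :
    ∃ e ∈ F, ∃ a b, Joins s t e a b ∧ a ∈ S ∧ b ∉ S := by
  by_contra! hcon
  refine hv (h (S : Set V) subset_rfl (fun e he ↦ ⟨fun hs ↦ ?_, fun ht ↦ ?_⟩) v)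
  · exact hcon e he (s e) (t e) (.inl ⟨rfl, rfl⟩) hs
  · exact hcon e he (t e) (s e) (.inr ⟨rfl, rfl⟩) ht

section Laplacian

variable [DecidableEq V]

/-- The row of the edge `e` in the signed incidence matrix. -/
def incidenceRow (s t : β → V) (e : β) : V → ℝ :=
  Pi.single (s e) 1 - Pi.single (t e) 1

/-- The Laplacian matrix of the graph with edge set `E`. -/
def laplacian (s t : β → V) (E : Finset β) : Matrix V V ℝ :=
  of fun x y ↦ ∑ e ∈ E, incidenceRow s t e x * incidenceRow s t e y

/-- The Laplacian matrix, with the rows of the vertices in `S` replaced by those of the identity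
matrix. -/
def groundedLaplacian (s t : β → V) (E : Finset β) (S : Finset V) : Matrix V V ℝ :=
  of fun x ↦ if x ∈ S then Pi.single x 1 else laplacian s t E x

lemma groundedLaplacian_row_of_mem {x : V} (hx : x ∈ S) :
    groundedLaplacian s t E S x = Pi.single x 1 :=
  if_pos hx

lemma groundedLaplacian_row_of_notMem {x : V} (hx : x ∉ S) :
    groundedLaplacian s t E S x = laplacian s t E x :=
  if_neg hx

lemma updateRow_groundedLaplacian (x : V) :
    (groundedLaplacian s t E S).updateRow x (Pi.single x 1) =
      groundedLaplacian s t E (insert x S) := by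
  ext y z
  by_cases hyx : y = x
  · subst hyx
    rw [updateRow_self, groundedLaplacian_row_of_mem (mem_insert_self _ _)]
  · rw [updateRow_ne hyx]
    simp [groundedLaplacian, hyx]

end Laplacian

variable [Fintype V]

/-- The edge sets in `E` of the spanning forests in which every component contains exactly one
vertex of `S`. -/
noncomputable def rootedForests (s t : β → V) (E : Finset β) (S : Finset V) :
    Finset (Finset β) :=
  open scoped Classical in {F ∈ E.powerset | F.card + S.card = Fintype.card V ∧ Spans s t F S}

lemma mem_rootedForests : F ∈ rootedForests s t E S ↔
    F ⊆ E ∧ F.card + S.card = Fintype.card V ∧ Spans s t F S := by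
  simp [rootedForests]

lemma Spans.exists_subset_card (h : Spans s t F S) :
    ∃ F' ⊆ F, Spans s t F' S ∧ F'.card + S.card = Fintype.card V := by
  classical
  induction F using Finset.strongInduction generalizing S with
  | H F ih =>
    by_cases hS : S = univ
    · subst hS
      exact ⟨∅, by simp, fun U hU _ v ↦ hU (by simp), by simp⟩
    · obtain ⟨v, hv⟩ : ∃ v, v ∉ S := by simpa [Finset.eq_univ_iff_forall] using hS
      obtain ⟨e, he, a, b, hab, ha, hb⟩ := h.exists_joins hv
      obtain ⟨F', hF', hspan, hcard⟩ :=
        ih _ (erase_ssubset he) ((spans_iff_of_joins he hab ha).1 h)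
      have heF' : e ∉ F' := fun h ↦ by simpa using hF' h
      refine ⟨insert e F', ?_, ?_, ?_⟩
      · exact insert_subset he (hF'.trans (erase_subset _ _))
      · rw [spans_iff_of_joins (mem_insert_self _ _) hab ha, erase_insert heF']
        exact hspan
      · rw [card_insert_of_notMem hb] at hcard
        rw [card_insert_of_notMem heF']
        omega

/-- Equality in this bound stands in for acyclicity throughout: `rootedForests` and `twoForests`
never mention cycles. -/
lemma Spans.card_le (h : Spans s t F S) : Fintype.card V ≤ F.card + S.card := by
  obtain ⟨F', hF', -, hcard⟩ := h.exists_subset_card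
  have := card_le_card hF'
  omega

lemma Spans.rootedForests_nonempty (h : Spans s t E S) : (rootedForests s t E S).Nonempty := by
  obtain ⟨F, hF, hspan, hcard⟩ := h.exists_subset_card
  exact ⟨F, mem_rootedForests.2 ⟨hF, hcard, hspan⟩⟩

/-- Deletion–contraction: forests avoiding `e` give the first term, those containing `e` the second.
-/
lemma card_rootedForests_eq_add [DecidableEq V] [DecidableEq β] (he : e ∈ E)
    (h : Joins s t e a b) (ha : a ∈ S) (hb : b ∉ S) :
    (rootedForests s t E S).card = (rootedForests s t (E.erase e) S).card +
      (rootedForests s t (E.erase e) (insert b S)).card := by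
  rw [← card_filter_add_card_filter_not (s := rootedForests s t E S) (fun F ↦ e ∉ F)]
  congr 1
  · congr 1
    ext F
    simp only [mem_filter, mem_rootedForests, subset_erase]
    tauto
  · refine card_bij' (fun F _ ↦ F.erase e) (fun F _ ↦ insert e F) ?_ ?_ ?_ ?_
    · intro F hF
      simp only [mem_filter, mem_rootedForests, not_not] at hF
      obtain ⟨⟨hFE, hcard, hspan⟩, heF⟩ := hF
      refine mem_rootedForests.2 ⟨erase_subset_erase _ hFE, ?_,
        (spans_iff_of_joins heF h ha).1 hspan⟩
      rw [card_insert_of_notMem hb, ← hcard, ← card_erase_add_one heF]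
      omega
    · intro F hF
      obtain ⟨hFE, hcard, hspan⟩ := mem_rootedForests.1 hF
      obtain ⟨hFE, heF⟩ := subset_erase.1 hFE
      simp only [mem_filter, mem_rootedForests, not_not, mem_insert_self, and_true]
      refine ⟨insert_subset he hFE, ?_, ?_⟩
      · rw [card_insert_of_notMem hb] at hcard
        rw [card_insert_of_notMem heF]
        omega
      · rw [spans_iff_of_joins (mem_insert_self _ _) h ha, erase_insert heF]
        exact hspan
    · intro F hF
      simp only [mem_filter, not_not] at hF
      exact insert_erase hF.2
    · intro F hF
      exact erase_insert (subset_erase.1 (mem_rootedForests.1 hF).1).2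

variable [DecidableEq V]

lemma dotProduct_incidenceRow (e : β) (h : V → ℝ) :
    incidenceRow s t e ⬝ᵥ h = h (s e) - h (t e) := by
  simp [incidenceRow, sub_dotProduct]

lemma laplacian_mulVec_apply (h : V → ℝ) (x : V) :
    (laplacian s t E *ᵥ h) x = ∑ e ∈ E, incidenceRow s t e x * (h (s e) - h (t e)) := by
  simp only [← dotProduct_incidenceRow, laplacian, mulVec, dotProduct, of_apply, sum_mul, mul_sum]
  rw [sum_comm]
  simp only [mul_assoc]

lemma groundedLaplacian_mulVec_of_mem (h : V → ℝ) {x : V} (hx : x ∈ S) :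
    (groundedLaplacian s t E S *ᵥ h) x = h x := by
  simp [mulVec, groundedLaplacian_row_of_mem hx]

lemma groundedLaplacian_mulVec_of_notMem (h : V → ℝ) {x : V} (hx : x ∉ S) :
    (groundedLaplacian s t E S *ᵥ h) x = (laplacian s t E *ᵥ h) x := by
  simp [mulVec, groundedLaplacian_row_of_notMem hx]

/-- The same recursion as for the forest count. As `a` is grounded, restoring `e` changes only row
`b`, by `Pi.single b 1 - Pi.single a 1`. By linearity in that row, the `b` part grounds `b`, and the
`a` part duplicates row `a` and vanishes. -/
lemma det_groundedLaplacian_eq_add [DecidableEq β] (he : e ∈ E)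
    (h : Joins s t e a b) (ha : a ∈ S) (hb : b ∉ S) :
    (groundedLaplacian s t E S).det = (groundedLaplacian s t (E.erase e) S).det +
      (groundedLaplacian s t (E.erase e) (insert b S)).det := by
  have hab : a ≠ b := fun h ↦ hb (h ▸ ha)
  have hlap (x : V) : laplacian s t E x =
      laplacian s t (E.erase e) x + incidenceRow s t e x • incidenceRow s t e := by
    ext y
    simp only [laplacian, of_apply, Pi.add_apply, Pi.smul_apply, smul_eq_mul]
    exact (sum_erase_add _ _ he).symm
  have hrow : laplacian s t E b = laplacian s t (E.erase e) b +
      (Pi.single b 1 + (-1 : ℝ) • Pi.single a 1) := by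
    rw [hlap]
    congr 1
    rcases h with ⟨rfl, rfl⟩ | ⟨rfl, rfl⟩ <;>
      ext y <;> simp [incidenceRow, hab.symm] <;> ring
  have hM : groundedLaplacian s t E S = (groundedLaplacian s t (E.erase e) S).updateRow b
      (laplacian s t (E.erase e) b + (Pi.single b 1 + (-1 : ℝ) • Pi.single a 1)) := by
    refine funext fun x ↦ ?_
    by_cases hxb : x = b
    · subst hxb
      rw [updateRow_self, groundedLaplacian_row_of_notMem hb, hrow]
    · rw [updateRow_ne hxb]
      by_cases hx : x ∈ S
      · rw [groundedLaplacian_row_of_mem hx, groundedLaplacian_row_of_mem hx]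
      · have hxa : x ≠ a := fun h ↦ hx (h ▸ ha)
        rw [groundedLaplacian_row_of_notMem hx, groundedLaplacian_row_of_notMem hx, hlap]
        have : incidenceRow s t e x = 0 := by
          rcases h with ⟨rfl, rfl⟩ | ⟨rfl, rfl⟩ <;> simp [incidenceRow, hxa, hxb]
        simp [this]
  have hzero : ((groundedLaplacian s t (E.erase e) S).updateRow b (Pi.single a 1)).det = 0 := by
    refine det_zero_of_row_eq hab ?_
    rw [updateRow_self, updateRow_ne hab, groundedLaplacian_row_of_mem ha]
  rw [hM, det_updateRow_add, det_updateRow_add, det_updateRow_smul, hzero,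
    updateRow_groundedLaplacian, ← groundedLaplacian_row_of_notMem (E := E.erase e) hb,
    updateRow_eq_self]
  simp

/-- The all-principal-minors **matrix tree theorem**. -/
theorem det_groundedLaplacian (s t : β → V) (E : Finset β) (S : Finset V) :
    (groundedLaplacian s t E S).det = (rootedForests s t E S).card := by
  classical
  induction E using Finset.strongInduction generalizing S with
  | H E ih =>
    by_cases hex : ∃ e ∈ E, ∃ a b, Joins s t e a b ∧ a ∈ S ∧ b ∉ S
    · obtain ⟨e, he, a, b, hab, ha, hb⟩ := hex
      rw [det_groundedLaplacian_eq_add he hab ha hb, card_rootedForests_eq_add he hab ha hb,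
        ih _ (erase_ssubset he), ih _ (erase_ssubset he)]
      push_cast
      rfl
    by_cases hS : S = univ
    · subst hS
      have hone : groundedLaplacian s t E univ = 1 := by
        ext x y
        simp [groundedLaplacian, one_apply, Pi.single_apply, eq_comm]
      have hrf : rootedForests s t E univ = {∅} := by
        ext F
        simp only [mem_rootedForests, mem_singleton, card_univ, add_eq_right, card_eq_zero]
        exact ⟨fun h ↦ h.2.1, fun h ↦ ⟨by simp [h], h, fun U hU _ v ↦ hU (by simp)⟩⟩
      simp [hone, hrf]
    · obtain ⟨v, hv⟩ : ∃ v, v ∉ S := by simpa [Finset.eq_univ_iff_forall] using hS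
      have hrf : rootedForests s t E S = ∅ := by
        refine eq_empty_of_forall_notMem fun F hF ↦ hex ?_
        obtain ⟨hFE, -, hspan⟩ := mem_rootedForests.1 hF
        obtain ⟨e, he, h⟩ := hspan.exists_joins hv
        exact ⟨e, hFE he, h⟩
      rw [hrf, card_empty, Nat.cast_zero, ← exists_mulVec_eq_zero_iff]
      -- No edge leaves `S`, so the indicator of its nonempty complement lies in the kernel.
      refine ⟨fun x ↦ if x ∈ S then 0 else 1, fun h ↦ ?_, ?_⟩
      · simpa [hv] using congrFun h v
      · ext x
        by_cases hx : x ∈ S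
        · simp [groundedLaplacian_mulVec_of_mem _ hx, hx]
        · rw [groundedLaplacian_mulVec_of_notMem _ hx, laplacian_mulVec_apply]
          refine sum_eq_zero fun e he ↦ ?_
          have : s e ∈ S ↔ t e ∈ S := by
            by_contra hcon
            refine hex ⟨e, he, ?_⟩
            by_cases hs : s e ∈ S
            · exact ⟨s e, t e, .inl ⟨rfl, rfl⟩, hs, by tauto⟩
            · exact ⟨t e, s e, .inr ⟨rfl, rfl⟩, by tauto, hs⟩
          simp [this]

end RootedForests

/-! ### Counting two-forests through the component avoiding the root. -/

section TwoForests

open Finset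

variable {V β : Type*} [Fintype V] [DecidableEq V] {s t : β → V} {E F : Finset β} {q x : V} {e : β}

/-- The edge sets in `E` of the spanning forests with two components. -/
noncomputable def twoForests (s t : β → V) (E : Finset β) (q : V) : Finset (Finset β) :=
  open scoped Classical in
  {F ∈ E.powerset | F.card + 2 = Fintype.card V ∧ ∃ x, Spans s t F {x, q}}

/-- For a two-forest `F`, the vertex set of the component that does not contain `q`. -/
noncomputable def otherPart (s t : β → V) (F : Finset β) (q : V) : Finset V :=
  open scoped Classical in {x | Spans s t F {x, q}}

lemma mem_twoForests : F ∈ twoForests s t E q ↔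
    F ⊆ E ∧ F.card + 2 = Fintype.card V ∧ ∃ x, Spans s t F {x, q} := by
  simp [twoForests]

lemma mem_otherPart : x ∈ otherPart s t F q ↔ Spans s t F {x, q} := by
  simp [otherPart]

lemma ne_of_mem_otherPart (hF : F.card + 2 = Fintype.card V) (hx : x ∈ otherPart s t F q) :
    x ≠ q := by
  rintro rfl
  have := (mem_otherPart.1 hx).card_le
  simp at this
  omega

lemma mem_otherPart_of_spans {y : V}
    (h : ∀ U : Set V, q ∈ U → (∀ e ∈ F, s e ∈ U ↔ t e ∈ U) → y ∈ U → x ∈ U)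
    (hx : x ∈ otherPart s t F q) : y ∈ otherPart s t F q := by
  rw [mem_otherPart] at hx ⊢
  intro U hU hcl
  simp only [coe_insert, coe_singleton, Set.insert_subset_iff, Set.singleton_subset_iff] at hU
  refine hx U ?_ hcl
  simp only [coe_insert, coe_singleton, Set.insert_subset_iff, Set.singleton_subset_iff]
  exact ⟨h U hU.2 hcl hU.1, hU.2⟩

lemma mem_otherPart_iff (he : e ∈ F) :
    s e ∈ otherPart s t F q ↔ t e ∈ otherPart s t F q :=
  ⟨mem_otherPart_of_spans fun _ _ hcl ↦ (hcl e he).2,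
    mem_otherPart_of_spans fun _ _ hcl ↦ (hcl e he).1⟩

/-- `Spans.card_le` bounds each side of the forest by its number of edges plus one. The two bounds
add up to `F.card + 2 = |V|`, so both are equalities. -/
lemma card_otherPart (hF : F.card + 2 = Fintype.card V) (hx : x ∈ otherPart s t F q) :
    (otherPart s t F q).card = (F.filter fun e ↦ s e ∈ otherPart s t F q).card + 1 := by
  classical
  set B := otherPart s t F q with hB
  have hqB : q ∉ B := fun h ↦ ne_of_mem_otherPart hF h rfl
  have hspan := mem_otherPart.1 hx
  have h₁ : Spans s t (F.filter fun e ↦ s e ∈ B) (insert x Bᶜ) := by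
    intro U hU hcl
    simp only [coe_insert, coe_compl, Set.insert_subset_iff] at hU
    have hBU : ∀ v, v ∉ B → v ∈ U := fun v hv ↦ hU.2 (by simpa using hv)
    refine hspan U ?_ fun e he ↦ ?_
    · simp only [coe_insert, coe_singleton, Set.insert_subset_iff, Set.singleton_subset_iff]
      exact ⟨hU.1, hBU q hqB⟩
    · by_cases hs : s e ∈ B
      · exact hcl e (mem_filter.2 ⟨he, hs⟩)
      · exact iff_of_true (hBU _ hs) (hBU _ fun ht ↦ hs ((mem_otherPart_iff he).2 ht))
  have h₂ : Spans s t (F.filter fun e ↦ s e ∉ B) (insert q B) := by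
    intro U hU hcl
    simp only [coe_insert, Set.insert_subset_iff] at hU
    have hBU : ∀ v, v ∈ B → v ∈ U := fun v hv ↦ hU.2 (by simpa using hv)
    refine hspan U ?_ fun e he ↦ ?_
    · simp only [coe_insert, coe_singleton, Set.insert_subset_iff, Set.singleton_subset_iff]
      exact ⟨hBU x hx, hU.1⟩
    · by_cases hs : s e ∈ B
      · exact iff_of_true (hBU _ hs) (hBU _ ((mem_otherPart_iff he).1 hs))
      · exact hcl e (mem_filter.2 ⟨he, hs⟩)
  have c₁ := h₁.card_le
  have c₂ := h₂.card_le
  have c₃ := card_filter_add_card_filter_not (s := F) (fun e ↦ s e ∈ B)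
  have c₄ := card_compl_add_card B
  have c₅ : (insert q B).card = B.card + 1 := card_insert_of_notMem hqB
  have c₆ : (insert x Bᶜ).card = Bᶜ.card + 1 := card_insert_of_notMem (by simpa using hx)
  omega

lemma card_twoForests_add_sum (s t : β → V) (E : Finset β) (q : V) [DecidableEq β] :
    (twoForests s t E q).card +
      ∑ e ∈ E, ((twoForests s t E q).filter fun F ↦ e ∈ F ∧ s e ∈ otherPart s t F q).card =
    ∑ x, ((twoForests s t E q).filter fun F ↦ x ∈ otherPart s t F q).card := by
  have h₁ : ∑ x, ((twoForests s t E q).filter fun F ↦ x ∈ otherPart s t F q).card =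
      ∑ F ∈ twoForests s t E q, (otherPart s t F q).card := by
    simp only [card_filter]
    rw [sum_comm]
    simp
  have h₂ : ∑ e ∈ E, ((twoForests s t E q).filter
        fun F ↦ e ∈ F ∧ s e ∈ otherPart s t F q).card =
      ∑ F ∈ twoForests s t E q, (F.filter fun e ↦ s e ∈ otherPart s t F q).card := by
    simp only [card_filter]
    rw [sum_comm]
    refine sum_congr rfl fun F hF ↦ ?_
    rw [← inter_eq_right.2 (mem_twoForests.1 hF).1, ← filter_mem_eq_inter, sum_filter]
    refine sum_congr rfl fun e he ↦ ?_
    by_cases heF : e ∈ F <;> simp [heF, he]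
  rw [h₁, h₂, card_eq_sum_ones, ← sum_add_distrib]
  refine sum_congr rfl fun F hF ↦ ?_
  obtain ⟨-, hcard, x, hx⟩ := mem_twoForests.1 hF
  rw [card_otherPart hcard (mem_otherPart.2 hx), add_comm]

lemma card_filter_mem_otherPart (hx : x ≠ q) :
    ((twoForests s t E q).filter fun F ↦ x ∈ otherPart s t F q).card =
      (rootedForests s t E {x, q}).card := by
  congr 1
  ext F
  simp only [mem_filter, mem_twoForests, mem_otherPart, mem_rootedForests, card_pair hx]
  exact ⟨fun h ↦ ⟨h.1.1, h.1.2.1, h.2⟩, fun h ↦ ⟨⟨h.1, h.2.1, x, h.2.2⟩, h.2.2⟩⟩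

lemma filter_mem_otherPart_self :
    (twoForests s t E q).filter (fun F ↦ q ∈ otherPart s t F q) = ∅ :=
  filter_eq_empty_iff.2 fun _ hF hq ↦ ne_of_mem_otherPart (mem_twoForests.1 hF).2.1 hq rfl

variable [DecidableEq β]

lemma spans_iff_erase_of_source_mem_otherPart (he : e ∈ F) :
    s e ∈ otherPart s t F q ↔ Spans s t (F.erase e) {t e, s e, q} := by
  rw [mem_otherPart]
  exact spans_iff_of_joins he (.inl ⟨rfl, rfl⟩) (by simp)

/-- Deleting `e` splits the component avoiding `q` into two pieces, rooted at the ends of `e`;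
adding `e` back reverses this. -/
lemma card_filter_edge_mem_otherPart (he : e ∈ E) (hs : s e ≠ q)
    (ht : t e ∉ ({s e, q} : Finset V)) :
    ((twoForests s t E q).filter fun F ↦ e ∈ F ∧ s e ∈ otherPart s t F q).card =
      (rootedForests s t E {t e, s e, q}).card := by
  have hthree : ({t e, s e, q} : Finset V).card = 3 := by
    rw [card_insert_of_notMem ht, card_pair hs]
  -- An edge joining two roots is redundant, so such a forest would still span with one edge too
  -- few.
  have hnot : ∀ F ∈ rootedForests s t E {t e, s e, q}, e ∉ F := by
    intro F hF heF
    obtain ⟨-, hcard, hspan⟩ := mem_rootedForests.1 hF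
    rw [spans_iff_of_joins heF (.inl ⟨rfl, rfl⟩) (by simp), insert_eq_of_mem (by simp)] at hspan
    have := hspan.card_le
    have := card_erase_add_one heF
    omega
  refine card_bij' (fun F _ ↦ F.erase e) (fun F _ ↦ insert e F) ?_ ?_ ?_ ?_
  · intro F hF
    obtain ⟨hF, heF, hsF⟩ := mem_filter.1 hF
    obtain ⟨hFE, hcard, -⟩ := mem_twoForests.1 hF
    refine mem_rootedForests.2 ⟨(erase_subset _ _).trans hFE, ?_,
      (spans_iff_erase_of_source_mem_otherPart heF).1 hsF⟩
    have := card_erase_add_one heF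
    omega
  · intro F hF
    have heF := hnot F hF
    obtain ⟨hFE, hcard, hspan⟩ := mem_rootedForests.1 hF
    have hmem : s e ∈ otherPart s t (insert e F) q := by
      rw [spans_iff_erase_of_source_mem_otherPart (mem_insert_self _ _), erase_insert heF]
      exact hspan
    refine mem_filter.2 ⟨mem_twoForests.2 ⟨insert_subset he hFE, ?_, s e, mem_otherPart.1 hmem⟩,
      mem_insert_self _ _, hmem⟩
    rw [card_insert_of_notMem heF]
    omega
  · intro F hF
    exact insert_erase (mem_filter.1 hF).2.1
  · intro F hF
    exact erase_insert (hnot F hF)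

lemma filter_edge_mem_otherPart_eq_empty (h : s e = q ∨ t e = q) :
    (twoForests s t E q).filter (fun F ↦ e ∈ F ∧ s e ∈ otherPart s t F q) = ∅ := by
  refine filter_eq_empty_iff.2 fun F hF ⟨heF, hs⟩ ↦ ?_
  have hcard := (mem_twoForests.1 hF).2.1
  have ht := (mem_otherPart_iff heF).1 hs
  exact h.elim (ne_of_mem_otherPart hcard hs) (ne_of_mem_otherPart hcard ht)

end TwoForests

/-! ### The Green function, Foster's theorem and the inequality. -/

section GreenFunction

open Finset Matrix

variable {V : Type*} [Fintype V] [DecidableEq V]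

/-- A rank-two perturbation of the identity: `det (1 + A * B) = det (1 + B * A)` reduces it to a 2 ×
2 determinant. -/
lemma det_updateRow_updateRow_one {x y : V} (hxy : x ≠ y) (u v : V → ℝ) :
    (((1 : Matrix V V ℝ).updateRow x u).updateRow y v).det = u x * v y - u y * v x := by
  let A : Matrix V (Fin 2) ℝ := of fun z i ↦ (![Pi.single x 1, Pi.single y 1] : Fin 2 → V → ℝ) i z
  let B : Matrix (Fin 2) V ℝ := of ![u - Pi.single x 1, v - Pi.single y 1]
  have hAB : ((1 : Matrix V V ℝ).updateRow x u).updateRow y v = 1 + A * B := by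
    ext z w
    simp only [Matrix.add_apply, mul_apply, Fin.sum_univ_two, A, B, of_apply, cons_val_zero,
      cons_val_one, Pi.sub_apply]
    by_cases hzy : z = y
    · subst hzy
      simp [hxy.symm, one_apply, Pi.single_apply, eq_comm]
    · by_cases hzx : z = x
      · subst hzx
        simp [hxy, one_apply, Pi.single_apply, eq_comm]
      · simp [hzy, hzx]
  rw [hAB, det_one_add_mul_comm, det_fin_two]
  simp only [Matrix.add_apply, mul_apply, A, B, of_apply, cons_val_zero, cons_val_one, Pi.sub_apply,
    Pi.single_apply]
  simp [hxy, hxy.symm]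

lemma det_updateRow_single_eq {A : Matrix V V ℝ} (hA : A.det ≠ 0) (x : V) :
    (A.updateRow x (Pi.single x 1)).det = A.det * A⁻¹ x x := by
  rw [← adjugate_apply, Matrix.inv_def]
  simp [hA]

/-- Jacobi's identity for a complementary 2 × 2 minor: factor `A` out on the right, leaving the
identity with two rows replaced by those of `A⁻¹`. -/
lemma det_updateRow_updateRow_single_eq {A : Matrix V V ℝ} (hA : A.det ≠ 0) {x y : V}
    (hxy : x ≠ y) :
    ((A.updateRow x (Pi.single x 1)).updateRow y (Pi.single y 1)).det =
      A.det * (A⁻¹ x x * A⁻¹ y y - A⁻¹ x y * A⁻¹ y x) := by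
  have hAu : IsUnit A.det := isUnit_iff_ne_zero.2 hA
  have h : (A.updateRow x (Pi.single x 1)).updateRow y (Pi.single y 1) =
      ((1 : Matrix V V ℝ).updateRow x (A⁻¹ x)).updateRow y (A⁻¹ y) * A := by
    have hinv (z w : V) : (A⁻¹ * A) z w = (Pi.single z 1 : V → ℝ) w := by
      rw [nonsing_inv_mul A hAu, one_apply, Pi.single_apply]
      simp [eq_comm]
    ext z w
    by_cases hzy : z = y
    · subst hzy
      rw [updateRow_self, ← hinv, mul_apply, mul_apply]
      simp
    · by_cases hzx : z = x
      · subst hzx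
        rw [updateRow_ne hxy, updateRow_self, ← hinv, mul_apply, mul_apply]
        simp [hxy]
      · rw [updateRow_ne hzy, updateRow_ne hzx, mul_apply]
        simp [hzy, hzx, one_apply]
  rw [h, det_mul, det_updateRow_updateRow_one hxy, mul_comm]

variable {β : Type*} {s t : β → V} {E : Finset β} {q : V}

/-- The Green function of the Laplacian, grounded at `q`. -/
noncomputable def green (s t : β → V) (E : Finset β) (q x y : V) : ℝ :=
  -- For invertible grounded Laplacian, column `q` of the inverse is constantly `1`; replacing it by
  -- zero makes the Green function symmetric.
  if y = q then 0 else (groundedLaplacian s t E {q})⁻¹ x y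

lemma green_right_self (x : V) : green s t E q x q = 0 := by
  simp [green]

lemma green_of_ne {x y : V} (hy : y ≠ q) :
    green s t E q x y = (groundedLaplacian s t E {q})⁻¹ x y := by
  simp [green, hy]

lemma groundedLaplacian_mulVec_green (hdet : (groundedLaplacian s t E {q}).det ≠ 0)
    {x y : V} (hy : y ≠ q) :
    (groundedLaplacian s t E {q} *ᵥ fun z ↦ green s t E q z y) x = if x = y then 1 else 0 := by
  rw [← one_apply, ← mul_nonsing_inv _ (isUnit_iff_ne_zero.2 hdet)]
  simp only [mulVec, dotProduct, mul_apply, green_of_ne hy]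

lemma green_left_self (hdet : (groundedLaplacian s t E {q}).det ≠ 0)
    (y : V) : green s t E q q y = 0 := by
  by_cases hy : y = q
  · rw [hy, green_right_self]
  · rw [← groundedLaplacian_mulVec_of_mem (S := {q}) (fun z ↦ green s t E q z y) (by simp),
      groundedLaplacian_mulVec_green hdet hy, if_neg (Ne.symm hy)]

lemma laplacian_mulVec_green (hdet : (groundedLaplacian s t E {q}).det ≠ 0)
    {x : V} (hx : x ≠ q) (y : V) :
    (laplacian s t E *ᵥ fun z ↦ green s t E q z y) x = if x = y then 1 else 0 := by
  by_cases hy : y = q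
  · subst hy
    simp [laplacian_mulVec_apply, green_right_self, hx]
  · rw [← groundedLaplacian_mulVec_of_notMem (S := {q}) _ (by simpa using hx),
      groundedLaplacian_mulVec_green hdet hy]

/-- The reproducing property of the Green function for the Dirichlet form, by summation by parts.
Symmetry of `green` follows from it. -/
lemma sum_mul_sub_green (hdet : (groundedLaplacian s t E {q}).det ≠ 0)
    {h : V → ℝ} (hq : h q = 0) (y : V) :
    ∑ e ∈ E, (h (s e) - h (t e)) * (green s t E q (s e) y - green s t E q (t e) y) = h y := by
  have h₁ : h ⬝ᵥ (laplacian s t E *ᵥ fun z ↦ green s t E q z y) = h y := by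
    have : ∀ x, h x * (laplacian s t E *ᵥ fun z ↦ green s t E q z y) x =
        if x = y then h x else 0 := by
      intro x
      by_cases hx : x = q
      · simp [hx, hq]
      · rw [laplacian_mulVec_green hdet hx]
        simp
    simp [dotProduct, this]
  rw [← h₁]
  simp only [dotProduct, laplacian_mulVec_apply, mul_sum]
  rw [sum_comm]
  refine sum_congr rfl fun e _ ↦ ?_
  rw [← dotProduct_incidenceRow, dotProduct, sum_mul]
  exact sum_congr rfl fun x _ ↦ by ring

lemma green_comm (hdet : (groundedLaplacian s t E {q}).det ≠ 0)
    (x y : V) : green s t E q x y = green s t E q y x := by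
  rw [← sum_mul_sub_green hdet (h := fun z ↦ green s t E q z y) (green_left_self hdet y) x,
    ← sum_mul_sub_green hdet (h := fun z ↦ green s t E q z x) (green_left_self hdet x) y]
  exact sum_congr rfl fun e _ ↦ mul_comm _ _

/-- The Laplacian applied to the Green function has diagonal `1` off `q` and `0` at `q`; weight it
by `w` and expand over edges. Constant `w` gives Foster's theorem, and `w x = green s t E q x x`
gives the sum of squares. -/
lemma sum_green_trace (hdet : (groundedLaplacian s t E {q}).det ≠ 0) (w : V → ℝ) :
    ∑ e ∈ E, (w (s e) * (green s t E q (s e) (s e) - green s t E q (s e) (t e)) +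
      w (t e) * (green s t E q (t e) (t e) - green s t E q (s e) (t e))) = ∑ x, w x - w q := by
  have h₁ (x : V) : w x * (laplacian s t E *ᵥ fun z ↦ green s t E q z x) x =
      w x - if x = q then w x else 0 := by
    by_cases hx : x = q
    · subst hx
      simp [laplacian_mulVec_apply, green_right_self]
    · simp [laplacian_mulVec_green hdet hx, hx]
  have h₂ : ∑ x, w x * (laplacian s t E *ᵥ fun z ↦ green s t E q z x) x = ∑ x, w x - w q := by
    simp [h₁]
  rw [← h₂]
  simp only [laplacian_mulVec_apply, mul_sum]
  rw [sum_comm]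
  refine sum_congr rfl fun e _ ↦ ?_
  have := dotProduct_incidenceRow (s := s) (t := t) e
    fun x ↦ w x * (green s t E q (s e) x - green s t E q (t e) x)
  rw [green_comm hdet (t e) (s e)] at this
  trans incidenceRow s t e ⬝ᵥ fun x ↦ w x * (green s t E q (s e) x - green s t E q (t e) x)
  · rw [this]
    ring
  · exact sum_congr rfl fun x _ ↦ by ring

/-- **Foster's theorem**. -/
lemma sum_resistance (hdet : (groundedLaplacian s t E {q}).det ≠ 0) :
    ∑ e ∈ E, (green s t E q (s e) (s e) + green s t E q (t e) (t e) -
      2 * green s t E q (s e) (t e)) = Fintype.card V - 1 := by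
  have := sum_green_trace hdet fun _ ↦ 1
  simp only [sum_const, card_univ, nsmul_eq_mul, mul_one] at this
  rw [← this]
  exact sum_congr rfl fun e _ ↦ by ring

lemma card_rootedForests_pair (hdet : (groundedLaplacian s t E {q}).det ≠ 0) {x : V} (hx : x ≠ q) :
    ((rootedForests s t E {x, q}).card : ℝ) =
      (groundedLaplacian s t E {q}).det * green s t E q x x := by
  rw [← det_groundedLaplacian, ← updateRow_groundedLaplacian, det_updateRow_single_eq hdet,
    green_of_ne hx]

lemma card_rootedForests_triple (hdet : (groundedLaplacian s t E {q}).det ≠ 0)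
    {x y : V} (hx : x ≠ q) (hy : y ≠ q) (hxy : x ≠ y) :
    ((rootedForests s t E {y, x, q}).card : ℝ) = (groundedLaplacian s t E {q}).det *
      (green s t E q x x * green s t E q y y - green s t E q x y ^ 2) := by
  rw [← det_groundedLaplacian, ← updateRow_groundedLaplacian, ← updateRow_groundedLaplacian,
    det_updateRow_updateRow_single_eq hdet hxy, sq]
  nth_rw 2 [green_comm hdet x y]
  rw [green_of_ne hx, green_of_ne hy, green_of_ne hx, green_of_ne hy]

lemma card_twoForests_eq (hdet : (groundedLaplacian s t E {q}).det ≠ 0)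
    (hloop : ∀ e ∈ E, s e ≠ t e) :
    ((twoForests s t E q).card : ℝ) = (groundedLaplacian s t E {q}).det *
      (∑ x, green s t E q x x - ∑ e ∈ E, (green s t E q (s e) (s e) * green s t E q (t e) (t e) -
        green s t E q (s e) (t e) ^ 2)) := by
  classical
  have h := congrArg (Nat.cast (R := ℝ)) (card_twoForests_add_sum s t E q)
  push_cast at h
  rw [eq_sub_of_add_eq h, mul_sub, mul_sum, mul_sum]
  congr 1
  · refine sum_congr rfl fun x _ ↦ ?_
    by_cases hx : x = q
    · subst hx
      simp [filter_mem_otherPart_self, green_right_self]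
    · rw [card_filter_mem_otherPart hx, card_rootedForests_pair hdet hx]
  · refine sum_congr rfl fun e he ↦ ?_
    by_cases hs : s e = q
    · rw [filter_edge_mem_otherPart_eq_empty (.inl hs)]
      simp [hs, green_left_self hdet]
    by_cases ht : t e = q
    · rw [filter_edge_mem_otherPart_eq_empty (.inr ht)]
      simp [ht, green_right_self]
    rw [card_filter_edge_mem_otherPart he hs (by simp [ht, (hloop e he).symm]),
      card_rootedForests_triple hdet hs ht (hloop e he)]

lemma card_twoForests_eq_sum_sq (hdet : (groundedLaplacian s t E {q}).det ≠ 0)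
    (hloop : ∀ e ∈ E, s e ≠ t e) :
    ((twoForests s t E q).card : ℝ) = (groundedLaplacian s t E {q}).det *
      ∑ e ∈ E, (1 / 4 * (green s t E q (s e) (s e) + green s t E q (t e) (t e) -
          2 * green s t E q (s e) (t e)) ^ 2 +
        3 / 4 * (green s t E q (s e) (s e) - green s t E q (t e) (t e)) ^ 2) := by
  have h := sum_green_trace hdet fun x ↦ green s t E q x x
  rw [green_right_self, sub_zero] at h
  rw [card_twoForests_eq hdet hloop, ← h, ← sum_sub_distrib]
  congr 1
  exact sum_congr rfl fun e _ ↦ by ring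

theorem sq_div_le_card_twoForests_div (hspan : Spans s t E {q}) (hloop : ∀ e ∈ E, s e ≠ t e) :
    ((Fintype.card V : ℝ) - 1) ^ 2 / (4 * (E.card : ℝ)) ≤
      ((twoForests s t E q).card : ℝ) / ((rootedForests s t E {q}).card : ℝ) := by
  have hpos : 0 < (groundedLaplacian s t E {q}).det := by
    rw [det_groundedLaplacian]
    exact_mod_cast hspan.rootedForests_nonempty.card_pos
  rw [← det_groundedLaplacian, card_twoForests_eq_sum_sq hpos.ne' hloop,
    mul_div_cancel_left₀ _ hpos.ne', ← sum_resistance hpos.ne']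
  -- Only nonnegativity of the denominator is needed, so an empty edge set is covered.
  refine div_le_of_le_mul₀ (by positivity) (sum_nonneg fun e _ ↦ by positivity) ?_
  -- Cauchy–Schwarz for the resistances; what remains is termwise, discarding the second square.
  refine (sq_sum_le_card_mul_sum_sq).trans ?_
  rw [mul_comm (∑ e ∈ E, (_ : ℝ)), mul_comm (4 : ℝ), mul_assoc]
  refine mul_le_mul_of_nonneg_left ?_ (by positivity)
  rw [mul_sum]
  refine sum_le_sum fun e _ ↦ ?_
  nlinarith [sq_nonneg (green s t E q (s e) (s e) - green s t E q (t e) (t e))]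

end GreenFunction

/-! ### Reachability and cycles in `Graph`. -/

variable {α β : Type*} {G H : Graph α β}

lemma Reachable.symm {x y : α} (h : G.Reachable x y) : G.Reachable y x := by
  have : Std.Symm G.Adj := ⟨fun _ _ ↦ Adj.symm⟩
  exact Relation.ReflTransGen.stdSymm.symm _ _ h

lemma Reachable.mono (hGH : G ≤ H) {x y : α} (h : G.Reachable x y) : H.Reachable x y :=
  Relation.ReflTransGen.mono (fun _ _ ↦ Adj.mono hGH) _ _ h

lemma component_eq_iff {x y : α} : G.component x = G.component y ↔ G.Reachable x y := by
  constructor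
  · intro h
    have : y ∈ G.component y := Relation.ReflTransGen.refl
    rwa [← h] at this
  · intro h
    ext z
    exact ⟨h.symm.trans, h.trans⟩

/-- Two ends of an edge `e` that remain joined by a path avoiding `e` lie on a cycle. -/
lemma hasCycle_of_reachable [H.Loopless] (hHG : H ≤ G) {e : β} (he : e ∉ H.edgeSet) {x y : α}
    (hlink : G.IsLink e x y) (hxy : H.Reachable x y) : G.HasCycle := by
  let K : SimpleGraph α := ⟨H.Adj, ⟨fun _ _ ↦ Adj.symm⟩, ⟨fun x ↦ H.not_adj_self x⟩⟩
  obtain ⟨p, hp⟩ := ((K.reachable_iff_reflTransGen x y).2 hxy).exists_isPath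
  have hadj : ∀ i, ∃ d, i < p.length → H.IsLink d (p.getVert i) (p.getVert (i + 1)) := by
    intro i
    by_cases hi : i < p.length
    · obtain ⟨d, hd⟩ := p.adj_getVert_succ hi
      exact ⟨d, fun _ ↦ hd⟩
    · exact ⟨e, fun h ↦ absurd h hi⟩
  choose d hd using hadj
  have hinj {i j : ℕ} (hi : i ≤ p.length) (hj : j ≤ p.length)
      (h : p.getVert i = p.getVert j) : i = j := hp.getVert_injOn hi hj h
  have hde {i : ℕ} (hi : i < p.length) : d i ≠ e := fun h ↦ he (h ▸ (hd i hi).edge_mem)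
  -- The path runs from `x` to `y`, and `e`, at the last index, closes it up.
  refine ⟨p.length, fun i ↦ p.getVert i, fun i ↦ if (i : ℕ) < p.length then d i else e,
    fun i j h ↦ Fin.ext (hinj (by omega) (by omega) h), fun i j h ↦ Fin.ext ?_, fun i ↦ ?_⟩
  · dsimp only at h
    split_ifs at h with hi hj hj
    · have h₁ := hd i hi
      have h₂ := hd j hj
      rw [h] at h₁
      rcases h₁.eq_and_eq_or_eq_and_eq h₂ with ⟨h₃, -⟩ | ⟨h₃, h₄⟩
      · exact hinj (by omega) (by omega) h₃
      · have := hinj (by omega) (by omega) h₃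
        have := hinj (by omega) (by omega) h₄
        omega
    · exact absurd h (hde hi)
    · exact absurd h.symm (hde hj)
    · omega
  · dsimp only
    split_ifs with hi
    · have : ((i + 1 : Fin (p.length + 1)) : ℕ) = i + 1 := by
        rw [Fin.val_add_one_of_lt']
        omega
      rw [this]
      exact (hd i hi).mono hHG
    · have : i = Fin.last p.length := Fin.ext (by simp; omega)
      subst this
      simpa using hlink.symm

/-- A cycle contains an edge whose ends remain reachable from each other when it is deleted. -/
lemma HasCycle.exists_isLink (h : G.HasCycle) :
    ∃ e x y, G.IsLink e x y ∧ (G.deleteEdges {e}).Reachable x y := by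
  obtain ⟨n, v, e, -, he, hlink⟩ := h
  refine ⟨e (Fin.last n), v 0, v (Fin.last n), ?_, ?_⟩
  · simpa using (hlink (Fin.last n)).symm
  · have key : ∀ i : Fin (n + 1), (G.deleteEdges {e (Fin.last n)}).Reachable (v 0) (v i) := by
      intro i
      induction i using Fin.induction with
      | zero => exact .refl
      | succ i ih =>
        refine ih.tail ⟨e i.castSucc, (deleteEdges_isLink ..).mpr ⟨?_, ?_⟩⟩
        · simpa using hlink i.castSucc
        · exact he.ne i.castSucc_lt_last.ne
    exact key _

/-! ### Spanning forests as edge sets. -/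

section Restrict

open Finset

variable {s t : β → G.vertexSet} {A : Finset β}

lemma restrict_adj_iff (hst : ∀ e ∈ G.edgeSet, G.IsLink e (s e) (t e)) {x y : α} :
    (G.restrict (A : Set β)).Adj x y ↔
      ∃ e ∈ A, e ∈ G.edgeSet ∧ (s e = x ∧ t e = y ∨ s e = y ∧ t e = x) := by
  simp only [Adj, restrict_isLink, mem_coe]
  refine exists_congr fun e ↦ and_congr_right fun _ ↦ ⟨fun h ↦ ⟨h.edge_mem, ?_⟩, fun ⟨he, h⟩ ↦ ?_⟩
  · rcases (hst e h.edge_mem).eq_and_eq_or_eq_and_eq h with h | h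
    · exact .inl h
    · exact .inr h
  · rcases h with ⟨rfl, rfl⟩ | ⟨rfl, rfl⟩
    · exact hst e he
    · exact (hst e he).symm

lemma reachable_mem_of_closed (hst : ∀ e ∈ G.edgeSet, G.IsLink e (s e) (t e))
    {U : Set G.vertexSet} (hU : ∀ e ∈ A, s e ∈ U ↔ t e ∈ U) {x y : G.vertexSet}
    (h : (G.restrict (A : Set β)).Reachable x y) (hx : x ∈ U) : y ∈ U := by
  have key : ∀ z : α, (G.restrict (A : Set β)).Reachable x z →
      ∃ hz, (⟨z, hz⟩ : G.vertexSet) ∈ U := by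
    intro z hz
    induction hz with
    | refl => exact ⟨x.2, hx⟩
    | tail _ hadj ih =>
      obtain ⟨hb, hbU⟩ := ih
      obtain ⟨e, he, -, ⟨h₁, h₂⟩ | ⟨h₁, h₂⟩⟩ := (restrict_adj_iff hst).1 hadj
      · subst h₂
        exact ⟨(t e).2, (hU e he).1 (by convert hbU)⟩
      · subst h₁
        exact ⟨(s e).2, (hU e he).2 (by convert hbU)⟩
  exact (key y h).2

lemma reachable_of_mem (hst : ∀ e ∈ G.edgeSet, G.IsLink e (s e) (t e))
    (hA : (A : Set β) ⊆ G.edgeSet) {e : β} (he : e ∈ A) :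
    (G.restrict (A : Set β)).Reachable (s e) (t e) :=
  .single ((restrict_adj_iff hst).2 ⟨e, he, hA he, .inl ⟨rfl, rfl⟩⟩)

lemma spans_iff_reachable (hst : ∀ e ∈ G.edgeSet, G.IsLink e (s e) (t e))
    (hA : (A : Set β) ⊆ G.edgeSet) {S : Finset G.vertexSet} :
    Spans s t A S ↔ ∀ v : G.vertexSet, ∃ r ∈ S, (G.restrict (A : Set β)).Reachable r v := by
  constructor
  · intro h
    refine h {v | ∃ r ∈ S, (G.restrict (A : Set β)).Reachable r v}
      (fun r hr ↦ ⟨r, hr, .refl⟩) fun e he ↦ ?_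
    have hr := reachable_of_mem hst hA he
    exact ⟨fun ⟨r, hrS, h⟩ ↦ ⟨r, hrS, h.trans hr⟩, fun ⟨r, hrS, h⟩ ↦ ⟨r, hrS, h.trans hr.symm⟩⟩
  · intro h U hSU hU v
    obtain ⟨r, hr, hrv⟩ := h v
    exact reachable_mem_of_closed hst hU hrv (hSU hr)

lemma numForests_eq_card {E : Finset β} (hE : (E : Set β) = G.edgeSet) {r : ℕ}
    {T : Finset (Finset β)} (hTE : ∀ A ∈ T, A ⊆ E)
    (hT : ∀ A ⊆ E, G.IsSpanningForest r (G.restrict (A : Set β)) ↔ A ∈ T) :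
    G.numForests r = T.card := by
  classical
  have himage : {F : Graph α β | G.IsSpanningForest r F} =
      (fun A : Finset β ↦ G.restrict (A : Set β)) '' T := by
    ext F
    constructor
    · intro hF
      have hFE : F.edgeSet ⊆ E := hE ▸ hF.isSpanningSubgraph.le.edgeSet_mono
      have hA : ((E.filter (· ∈ F.edgeSet) : Finset β) : Set β) = F.edgeSet := by
        ext e
        simpa using fun he ↦ hFE he
      have hFA : G.restrict ((E.filter (· ∈ F.edgeSet) : Finset β) : Set β) = F := by
        rw [hA]
        refine (Compatible.of_le_le (G := G) restrict_le hF.isSpanningSubgraph.le).ext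
          hF.isSpanningSubgraph.vertexSet_eq.symm ?_
        simpa using hF.isSpanningSubgraph.le.edgeSet_mono
      refine ⟨_, (hT _ (filter_subset _ _)).1 ?_, hFA⟩
      rw [hFA]
      exact hF
    · rintro ⟨A, hA, rfl⟩
      exact (hT A (hTE A hA)).2 hA
  rw [numForests, himage, Set.InjOn.ncard_image, Set.ncard_coe_finset]
  intro A hA B hB hAB
  have h := congrArg edgeSet hAB
  have hA' := hE ▸ coe_subset.2 (hTE A hA)
  have hB' := hE ▸ coe_subset.2 (hTE B hB)
  simpa [Set.inter_eq_right.2 hA', Set.inter_eq_right.2 hB'] using h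

lemma components_eq_range (A : Set β) :
    {C : Set α | ∃ x ∈ (G.restrict A).vertexSet, C = (G.restrict A).component x} =
      Set.range fun x : G.vertexSet ↦ (G.restrict A).component x := by
  ext C
  simp [eq_comm]

lemma numComponents_le_of_spans (hst : ∀ e ∈ G.edgeSet, G.IsLink e (s e) (t e))
    (hA : (A : Set β) ⊆ G.edgeSet) {S : Finset G.vertexSet} (h : Spans s t A S) :
    (G.restrict (A : Set β)).numComponents ≤ S.card := by
  have hsub : (Set.range fun x : G.vertexSet ↦ (G.restrict (A : Set β)).component x) ⊆
      (fun x : G.vertexSet ↦ (G.restrict (A : Set β)).component x) '' S := by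
    rintro _ ⟨v, rfl⟩
    obtain ⟨r, hr, hrv⟩ := (spans_iff_reachable hst hA).1 h v
    exact ⟨r, hr, component_eq_iff.2 hrv⟩
  rw [numComponents, components_eq_range]
  refine (Set.ncard_le_ncard hsub (S.finite_toSet.image _)).trans ?_
  exact (Set.ncard_image_le S.finite_toSet).trans (Set.ncard_coe_finset S).le

variable [Fintype G.vertexSet]

/-- One vertex is chosen from each component, with `q` representing its own. -/
lemma exists_transversal (hst : ∀ e ∈ G.edgeSet, G.IsLink e (s e) (t e))
    (hA : (A : Set β) ⊆ G.edgeSet) (q : G.vertexSet) :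
    ∃ S : Finset G.vertexSet, q ∈ S ∧ S.card = (G.restrict (A : Set β)).numComponents ∧
      Spans s t A S ∧ ∀ x ∈ S, ∀ y ∈ S, (G.restrict (A : Set β)).Reachable x y → x = y := by
  classical
  obtain ⟨r, hqr, hr⟩ := Set.BijOn.exists_extend (Set.bijOn_singleton.2 rfl :
      Set.BijOn (fun x : G.vertexSet ↦ (G.restrict (A : Set β)).component x) {q} {_})
    (Set.singleton_subset_iff.2 (Set.mem_range_self q)) subset_rfl
  refine ⟨r.toFinset, by simpa using hqr, ?_, ?_, ?_⟩
  · rw [numComponents, components_eq_range, ← hr.image_eq, hr.injOn.ncard_image,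
      Set.ncard_eq_toFinset_card']
  · rw [spans_iff_reachable hst hA]
    intro v
    obtain ⟨x, hx, hxv⟩ := hr.surjOn (Set.mem_range_self v)
    exact ⟨x, by simpa using hx, component_eq_iff.1 hxv⟩
  · intro x hx y hy h
    exact hr.injOn (by simpa using hx) (by simpa using hy) (component_eq_iff.2 h)

/-- A graph is a forest if and only if the numbers of its edges and components add up to the number
of its vertices. -/
lemma not_hasCycle_restrict_iff [G.Loopless] (hst : ∀ e ∈ G.edgeSet, G.IsLink e (s e) (t e))
    (hA : (A : Set β) ⊆ G.edgeSet) (q : G.vertexSet) :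
    ¬ (G.restrict (A : Set β)).HasCycle ↔
      A.card + (G.restrict (A : Set β)).numComponents = Fintype.card G.vertexSet := by
  classical
  obtain ⟨S, -, hcard, hspan, hS⟩ := exists_transversal hst hA q
  rw [← hcard]
  constructor
  -- An edge of `A` outside a minimal spanning `F ⊆ A` has both ends joined within `F` to the same
  -- root, so it closes a cycle.
  · intro hcyc
    obtain ⟨F, hFA, hF, hFcard⟩ := hspan.exists_subset_card
    suffices F = A by rwa [← this]
    refine hFA.antisymm fun e he ↦ ?_
    by_contra heF
    have hFE : (F : Set β) ⊆ G.edgeSet := (coe_subset.2 hFA).trans hA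
    have hle : G.restrict (F : Set β) ≤ G.restrict (A : Set β) :=
      G.restrict_mono_right (coe_subset.2 hFA)
    obtain ⟨x, hx, hxs⟩ := (spans_iff_reachable hst hFE).1 hF (s e)
    obtain ⟨y, hy, hyt⟩ := (spans_iff_reachable hst hFE).1 hF (t e)
    have hxy : x = y := hS x hx y hy
      ((hxs.mono hle).trans ((reachable_of_mem hst hA he).trans (hyt.mono hle).symm))
    subst hxy
    have : (G.restrict (F : Set β)).Loopless := Loopless.anti restrict_le
    exact hcyc (hasCycle_of_reachable hle (e := e) (by simp [heF])
      ((restrict_isLink ..).mpr ⟨he, hst e (hA he)⟩) (hxs.symm.trans hyt))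
  -- Deleting a suitable edge of the cycle keeps `S` spanning, with fewer edges than `Spans.card_le`
  -- allows.
  · intro hcount hcyc
    obtain ⟨e, x, y, hlink, hreach⟩ := hcyc.exists_isLink
    obtain ⟨heA, hlinkG⟩ := (restrict_isLink ..).mp hlink
    have hdel : (G.restrict (A : Set β)).deleteEdges {e} =
        G.restrict ((A.erase e : Finset β) : Set β) := by
      refine (Compatible.of_le_le (G := G) (deleteEdges_le.trans restrict_le) restrict_le).ext
        (by simp) ?_
      simp [Set.inter_sdiff_assoc]
    rw [hdel] at hreach
    have hreach' : (G.restrict ((A.erase e : Finset β) : Set β)).Reachable (s e) (t e) := by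
      rcases (hst e (hA heA)).eq_and_eq_or_eq_and_eq hlinkG with ⟨h₁, h₂⟩ | ⟨h₁, h₂⟩
      · rwa [h₁, h₂]
      · rw [h₁, h₂]
        exact hreach.symm
    have hspan' : Spans s t (A.erase e) S := by
      intro U hSU hU
      refine hspan U hSU fun d hd ↦ ?_
      by_cases hde : d = e
      · subst hde
        exact ⟨reachable_mem_of_closed hst hU hreach',
          reachable_mem_of_closed hst hU hreach'.symm⟩
      · exact hU d (mem_erase.2 ⟨hde, hd⟩)
    have := hspan'.card_le
    have := card_erase_add_one (mem_coe.1 heA)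
    omega

/-- A transversal also spans, so `Spans.card_le` makes it at least as large as `S`;
`numComponents_le_of_spans` is the other direction. -/
lemma numComponents_eq_of_spans (hst : ∀ e ∈ G.edgeSet, G.IsLink e (s e) (t e))
    (hA : (A : Set β) ⊆ G.edgeSet) {S : Finset G.vertexSet} (h : Spans s t A S)
    (hcard : A.card + S.card = Fintype.card G.vertexSet) (q : G.vertexSet) :
    (G.restrict (A : Set β)).numComponents = S.card := by
  obtain ⟨T, -, hT, hspan, -⟩ := exists_transversal hst hA q
  have := hspan.card_le
  have := numComponents_le_of_spans hst hA h
  omega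

lemma isSpanningForest_restrict_iff [G.Loopless] (hst : ∀ e ∈ G.edgeSet, G.IsLink e (s e) (t e))
    (hA : (A : Set β) ⊆ G.edgeSet) (q : G.vertexSet) (r : ℕ) :
    G.IsSpanningForest r (G.restrict (A : Set β)) ↔
      A.card + r = Fintype.card G.vertexSet ∧
        ∃ S : Finset G.vertexSet, q ∈ S ∧ S.card = r ∧ Spans s t A S := by
  constructor
  · rintro ⟨-, hcyc, rfl⟩
    obtain ⟨S, hq, hcard, hspan, -⟩ := exists_transversal hst hA q
    exact ⟨(not_hasCycle_restrict_iff hst hA q).1 hcyc, S, hq, hcard, hspan⟩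
  · rintro ⟨hcard, S, -, rfl, hspan⟩
    have h := numComponents_eq_of_spans hst hA hspan hcard q
    exact ⟨⟨restrict_le, rfl⟩, (not_hasCycle_restrict_iff hst hA q).2 (h ▸ hcard), h⟩

lemma isSpanningForest_one_restrict_iff [G.Loopless]
    (hst : ∀ e ∈ G.edgeSet, G.IsLink e (s e) (t e)) {E : Finset β}
    (hE : (E : Set β) = G.edgeSet) (hA : A ⊆ E) (q : G.vertexSet) :
    G.IsSpanningForest 1 (G.restrict (A : Set β)) ↔ A ∈ rootedForests s t E {q} := by
  rw [isSpanningForest_restrict_iff hst (hE ▸ coe_subset.2 hA) q, mem_rootedForests,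
    card_singleton]
  refine ⟨fun ⟨hcard, S, hq, hS, hspan⟩ ↦ ⟨hA, hcard, ?_⟩,
    fun ⟨_, hcard, hspan⟩ ↦ ⟨hcard, {q}, by simp, by simp, hspan⟩⟩
  obtain ⟨a, rfl⟩ := card_eq_one.1 hS
  rwa [mem_singleton.1 hq]

variable [DecidableEq G.vertexSet]

lemma isSpanningForest_two_restrict_iff [G.Loopless]
    (hst : ∀ e ∈ G.edgeSet, G.IsLink e (s e) (t e)) {E : Finset β}
    (hE : (E : Set β) = G.edgeSet) (hA : A ⊆ E) (q : G.vertexSet) :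
    G.IsSpanningForest 2 (G.restrict (A : Set β)) ↔ A ∈ twoForests s t E q := by
  rw [isSpanningForest_restrict_iff hst (hE ▸ coe_subset.2 hA) q, mem_twoForests]
  refine ⟨fun ⟨hcard, S, hq, hS, hspan⟩ ↦ ⟨hA, hcard, ?_⟩, fun ⟨_, hcard, x, hspan⟩ ↦
    ⟨hcard, {x, q}, by simp, card_pair (ne_of_mem_otherPart hcard (mem_otherPart.2 hspan)), hspan⟩⟩
  obtain ⟨x, hx⟩ := card_eq_one.1 (show (S.erase q).card = 1 by rw [card_erase_of_mem hq, hS])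
  refine ⟨x, ?_⟩
  rwa [← insert_erase hq, hx, pair_comm] at hspan

end Restrict

end Graph

theorem theoremA {α β : Type*} (G : Graph α β) (hV : G.vertexSet.Finite) (hE : G.edgeSet.Finite)
    (hloop : G.Loopless) (hconn : G.IsConnected) :
    (G.numForests 2 : ℝ) / (G.numSpanningTrees : ℝ) ≥
      ((G.vertexSet.ncard : ℝ) - 1) ^ 2 / (4 * (G.edgeSet.ncard : ℝ)) := by
  classical
  obtain ⟨⟨q, hq⟩, hreach⟩ := hconn
  have : Fintype G.vertexSet := hV.fintype
  have hends : ∀ e, ∃ x y : G.vertexSet, e ∈ G.edgeSet → G.IsLink e x y := by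
    intro e
    by_cases he : e ∈ G.edgeSet
    · obtain ⟨x, y, hxy⟩ := G.exists_isLink_of_mem_edgeSet he
      exact ⟨⟨x, hxy.left_mem⟩, ⟨y, hxy.right_mem⟩, fun _ ↦ hxy⟩
    -- Labels in `β` that are not edges receive dummy ends.
    · exact ⟨⟨q, hq⟩, ⟨q, hq⟩, fun h ↦ absurd h he⟩
  choose s t hst using hends
  have hcoe : (hE.toFinset : Set β) = G.edgeSet := hE.coe_toFinset
  have hspan : Graph.Spans s t hE.toFinset {(⟨q, hq⟩ : G.vertexSet)} := by
    rw [Graph.spans_iff_reachable hst hcoe.subset, hcoe, Graph.restrict_self]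
    exact fun v ↦ ⟨⟨q, hq⟩, by simp, hreach q hq v v.2⟩
  have key := Graph.sq_div_le_card_twoForests_div hspan fun e he h ↦
    (hst e (by simpa using he)).ne (congrArg Subtype.val h)
  rw [Graph.numSpanningTrees,
    Graph.numForests_eq_card hcoe (fun A hA ↦ (Graph.mem_rootedForests.1 hA).1)
      fun A hA ↦ Graph.isSpanningForest_one_restrict_iff hst hcoe hA ⟨q, hq⟩,
    Graph.numForests_eq_card hcoe (fun A hA ↦ (Graph.mem_twoForests.1 hA).1)
      fun A hA ↦ Graph.isSpanningForest_two_restrict_iff hst hcoe hA ⟨q, hq⟩,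
    Set.ncard_eq_toFinset_card _ hE, ← Nat.card_coe_set_eq, Nat.card_eq_fintype_card]
  exact key
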